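/- Let $\mathcal A$ be a commutative unital C*-algebra and let $\mathcal M$ be a full Hilbert $\mathcal A$-module, that is, a (left) Hilbert C*-module over $\mathcal A$, complete in the norm $\|x\|=\|\langle x,x\rangle\|^{1/2}$, such that the closed linear span of $\{\langle x,y\rangle : x,y\in\mathcal M\}$ is $\mathcal A$. Let $\mathrm{End}_{\mathcal A}(\mathcal M)$ be the complex algebra of all bounded $\mathcal A$-linear mappings from $\mathcal M$ into itself (not necessarily adjointable). A derivation on $\mathrm{End}_{\mathcal A}(\mathcal M)$ is a ($\mathbb C$-)linear mapping $d$ from $\mathrm{End}_{\mathcal A}(\mathcal M)$ into itself such that $d(ST)=d(S)T+Sd(T)$ for all $S,T$. A 2-local derivation on $\mathrm{End}_{\mathcal A}(\mathcal M)$ is a mapping $\delta$ from $\mathrm{End}_{\mathcal A}(\mathcal M)$ into itself, not assumed linear or continuous, such that for all $S,T\in\mathrm{End}_{\mathcal A}(\mathcal M)$ there is a derivation $d_{S,T}$ on $\mathrm{End}_{\mathcal A}(\mathcal M)$ with $\delta(S)=d_{S,T}(S)$ and $\delta(T)=d_{S,T}(T)$. Then each 2-local derivation on $\mathrm{End}_{\mathcal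 A}(\mathcal M)$ is a derivation. -/

import Mathlib

noncomputable section HilbertModuleEnd

section Module

variable (A M : Type*) [CommCStarAlgebra A] [PartialOrder A]
  [NormedAddCommGroup M] [NormedSpace ℂ M] [Module A M] [CStarModule A M]

/-- In a Hilbert module the action of the C⋆-algebra commutes with the action of `ℂ`. -/
theorem hilbertModule_smul_comm (c : ℂ) (a : A) (x : M) : a • (c • x) = c • (a • x) := by
  have h : ∀ u : M, inner A u (a • (c • x) - c • (a • x)) = 0 := by
    intro u
    simp
  exact sub_eq_zero.mp (CStarModule.inner_self.mp (h _))

/-- The Hilbert `A`-module `M` is full: the closed linear span of all inner products of elements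
of `M` is the whole of `A`. -/
def IsFullHilbertModule : Prop :=
  (Submodule.span ℂ (Set.range fun p : M × M => inner A p.1 p.2)).topologicalClosure = ⊤

/-- The complex algebra of all bounded `A`-linear operators on the Hilbert `A`-module `M`. -/
def HilbertModuleEnd : Subalgebra ℂ (M →L[ℂ] M) where
  carrier := {T | ∀ (a : A) (x : M), T (a • x) = a • T x}
  mul_mem' := by
    intro S T hS hT a x
    change S (T (a • x)) = a • S (T x)
    rw [hT, hS]
  add_mem' := by
    intro S T hS hT a x
    change S (a • x) + T (a • x) = a • (S x + T x)
    rw [hS, hT, smul_add]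
  algebraMap_mem' := by
    intro c a x
    change c • (a • x) = a • (c • x)
    exact (hilbertModule_smul_comm A M c a x).symm

end Module

section Derivation

variable {B : Type*} [Ring B] [Algebra ℂ B]

/-- A map `d` on a complex algebra is a derivation: it is linear and satisfies the Leibniz rule. -/
structure IsAlgDerivation (d : B → B) : Prop where
  isLinearMap : IsLinearMap ℂ d
  leibniz : ∀ x y : B, d (x * y) = d x * y + x * d y

/-- A map `δ`, not assumed to be linear or continuous, on a complex algebra is a 2-local
derivation: at any two elements it agrees with some derivation, which may depend on them. -/
def IsTwoLocalDerivation (δ : B → B) : Prop :=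
  ∀ x y : B, ∃ d : B → B, IsAlgDerivation d ∧ δ x = d x ∧ δ y = d y

end Derivation

end HilbertModuleEnd

/-! ### Jordan derivations of semiprime algebras. -/

section SemiprimeJordan

variable {B : Type*} [Ring B] [Algebra ℂ B]

/-! Derivations of the operator algebra vanish on scalar operators (`derivation_scalar`), hence are
`A`-linear. For a rank one `F`, the product `F T F` is a scalar multiple of `F`; applying a
derivation that agrees with `δ` at `T` and `F` expresses `F δ(T) F` additively in `T`
(`twoLocalDerivation_compression`). Rank one compressions separate operators, so `δ` is additive.
The pair `T * T`, `T` makes `δ` a Jordan derivation, and semiprimeness, again from rank one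
operators, makes it a derivation. -/

/-- A linear Jordan derivation on a complex semiprime algebra is a derivation. -/
theorem isAlgDerivation_of_jordan (hB : ∀ a : B, (∀ x, a * x * a = 0) → a = 0)
    (δ : B → B) (hlin : IsLinearMap ℂ δ) (hJ : ∀ x, δ (x * x) = δ x * x + x * δ x) :
    IsAlgDerivation δ := by
  have hadd := hlin.map_add
  have hsub := hlin.map_sub
  have hzero := hlin.map_zero
  have two : ∀ u v : B, u + u = v + v → u = v := by
    intro u v h
    rw [← two_smul ℂ u, ← two_smul ℂ v] at h
    exact smul_right_injective B (two_ne_zero (α := ℂ)) h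
  have J2 : ∀ x y, δ (x * y + y * x) = δ x * y + x * δ y + δ y * x + y * δ x := by
    intro x y
    have h : x * y + y * x = (x + y) * (x + y) - x * x - y * y := by noncomm_ring
    rw [h, hsub, hsub, hJ, hJ, hJ, hadd]
    noncomm_ring
  have J3 : ∀ x y, δ (x * y * x) = δ x * y * x + x * δ y * x + x * y * δ x := by
    intro x y
    apply two
    have h : x * y * x + x * y * x
        = (x * (x * y + y * x) + (x * y + y * x) * x) - ((x * x) * y + y * (x * x)) := by
      noncomm_ring
    rw [← hadd, h, hsub, J2, J2, J2, hJ]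
    noncomm_ring
  have J4 : ∀ x y z, δ (x * y * z + z * y * x)
      = δ x * y * z + x * δ y * z + x * y * δ z + δ z * y * x + z * δ y * x + z * y * δ x := by
    intro x y z
    have h : x * y * z + z * y * x = (x + z) * y * (x + z) - x * y * x - z * y * z := by
      noncomm_ring
    rw [h, hsub, hsub, J3, J3, J3, hadd]
    noncomm_ring
  -- The Leibniz defect; the goal is `p = 0`.
  obtain ⟨p, hp⟩ : ∃ p : B → B → B, ∀ a b, p a b = δ (a * b) - δ a * b - a * δ b :=
    ⟨_, fun _ _ => rfl⟩
  have p_add_left : ∀ a a' b, p (a + a') b = p a b + p a' b := by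
    intro a a' b
    rw [hp, hp, hp, add_mul, hadd, hadd]
    noncomm_ring
  have p_add_right : ∀ a b b', p a (b + b') = p a b + p a b' := by
    intro a b b'
    rw [hp, hp, hp, mul_add, hadd, hadd]
    noncomm_ring
  have p_swap : ∀ a b, p b a = - p a b := by
    intro a b
    have h := J2 a b
    rw [hadd] at h
    rw [hp, hp, eq_sub_of_add_eq h]
    noncomm_ring
  -- Expand `δ` of `abxba + baxab` under two groupings: nested `J3` against `J4`.
  have key : ∀ a b x, p a b * x * (a * b - b * a) + (a * b - b * a) * x * p a b = 0 := by
    intro a b x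
    have e1 : δ (a * (b * x * b) * a + b * (a * x * a) * b)
        = δ ((a * b) * x * (b * a) + (b * a) * x * (a * b)) := by
      congr 1; noncomm_ring
    rw [hadd, J3, J3, J3, J3, J4] at e1
    have e2 := p_swap a b
    have e3 : p a b * x * (b * a) + (a * b) * x * p b a + p b a * x * (a * b)
        + (b * a) * x * p a b = 0 := by
      rw [hp, hp]
      rw [← sub_eq_zero] at e1
      rw [← neg_eq_zero, ← e1]
      noncomm_ring
    rw [e2] at e3
    rw [← neg_eq_zero, ← e3]
    noncomm_ring
  -- By `key`, `r` and `q` swap across any middle factor with a sign; an odd number of swaps returns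
  -- `(rxq)y(rxq)` to itself.
  have z1 : ∀ a b x, p a b * x * (a * b - b * a) = 0 := by
    intro a b x
    have k := key a b
    generalize p a b = r at k ⊢
    generalize a * b - b * a = q at k ⊢
    have k' : ∀ x, r * x * q = - (q * x * r) := fun x => eq_neg_of_add_eq_zero_left (k x)
    apply hB
    intro y
    apply two
    have h1 : r * x * q * y * (r * x * q) = r * x * (q * y * r) * x * q := by noncomm_ring
    have h2 : r * x * (q * y * r) * x * q = -(r * (x * r * y) * q * x * q) := by
      have : q * y * r = - (r * y * q) := by rw [k', neg_neg]
      rw [this]; noncomm_ring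
    have h3 : r * x * q * y * (r * x * q) = - (r * x * q * y * (q * x * r)) := by
      rw [k' x]; noncomm_ring
    have h4 : r * x * q * y * (q * x * r) = r * (x * q * y) * q * (x * r) := by noncomm_ring
    have h5 : r * (x * q * y) * q * (x * r) = - (q * x * (q * y * r) * x * r) := by
      rw [k']; noncomm_ring
    have h6 : q * x * (q * y * r) * x * r = - (q * x * r * y * (q * x * r)) := by
      have : q * y * r = - (r * y * q) := by rw [k', neg_neg]
      rw [this]; noncomm_ring
    have h7 : q * x * r * y * (q * x * r) = r * x * q * y * (r * x * q) := by
      rw [k' x]; noncomm_ring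
    rw [h4, h5, h6, h7] at h3
    rw [add_zero, ← sub_eq_zero]
    have := congrArg (fun t => t + r * x * q * y * (r * x * q)) h3
    simpa using this
  -- Linearize `z1` in `a`; the sandwiched square then contains a factor killed by `z1`.
  have z2 : ∀ a b c x, p a b * x * (c * b - b * c) = 0 := by
    intro a b c x
    have lin : ∀ w, p a b * w * (c * b - b * c) = - (p c b * w * (a * b - b * a)) := by
      intro w
      have h := z1 (a + c) b w
      rw [p_add_left] at h
      have h1 := z1 a b w
      have h2 := z1 c b w
      rw [← sub_eq_zero, ← h, ← sub_eq_zero]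
      trans -(p a b * w * (a * b - b * a) + p c b * w * (c * b - b * c))
      · noncomm_ring
      · rw [h1, h2]; simp
    apply hB
    intro y
    have h : p a b * x * (c * b - b * c) * y * (p a b * x * (c * b - b * c))
        = - (p a b * (x * (c * b - b * c) * y * p c b * x) * (a * b - b * a)) := by
      trans p a b * x * (c * b - b * c) * y * (-(p c b * x * (a * b - b * a)))
      · rw [← lin x]
      · noncomm_ring
    rw [h, z1, neg_zero]
  have z3 : ∀ a b c d x, p a b * x * (c * d - d * c) = 0 := by
    intro a b c d x
    have lin : ∀ w, p a b * w * (c * d - d * c) = - (p a d * w * (c * b - b * c)) := by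
      intro w
      have h := z2 a (b + d) c w
      rw [p_add_right] at h
      have h1 := z2 a b c w
      have h2 := z2 a d c w
      rw [← sub_eq_zero, ← h, ← sub_eq_zero]
      trans -(p a b * w * (c * b - b * c) + p a d * w * (c * d - d * c))
      · noncomm_ring
      · rw [h1, h2]; simp
    apply hB
    intro y
    have h : p a b * x * (c * d - d * c) * y * (p a b * x * (c * d - d * c))
        = - (p a b * (x * (c * d - d * c) * y * p a d * x) * (c * b - b * c)) := by
      trans p a b * x * (c * d - d * c) * y * (-(p a d * x * (c * b - b * c)))
      · rw [← lin x]
      · noncomm_ring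
    rw [h, z2, neg_zero]
  have central : ∀ a b c, c * p a b = p a b * c := by
    intro a b c
    rw [← sub_eq_zero]
    apply hB
    intro x
    have h1 := z3 a b c (p a b) x
    have h2 := z3 a b c (p a b) (c * x)
    trans c * (p a b * x * (c * p a b - p a b * c)) - p a b * (c * x) * (c * p a b - p a b * c)
    · noncomm_ring
    · rw [h1, h2]; simp
  refine ⟨hlin, fun a b => ?_⟩
  have hcen := central a b
  have hpq : p a b * (a * b - b * a) = 0 := by simpa using z3 a b a b 1
  have hpc : ∀ c d, p a b * (c * d - d * c) = 0 := fun c d => by simpa using z3 a b c d 1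
  -- By antisymmetry, `2p` is `δ` of a commutator minus two commutators, and `p` annihilates
  -- commutators.
  have hpp : p a b * p a b + p a b * p a b = p a b * δ (a * b - b * a) := by
    have h1 := hpc (δ a) b
    have h2 := hpc a (δ b)
    have h3 : p a b + p a b
        = δ (a * b - b * a) - (δ a * b - b * δ a) - (a * δ b - δ b * a) := by
      nth_rewrite 2 [← neg_neg (p a b)]
      rw [← p_swap, hp, hp, hsub]
      noncomm_ring
    rw [← mul_add, h3, mul_sub, mul_sub, h1, h2, sub_zero, sub_zero]
  generalize hq : a * b - b * a = q at hpq hpp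
  -- Apply `J2` to `p` and `q`, whose products vanish, then multiply by the central `p`.
  have hppq : p a b * p a b * δ q = 0 := by
    have h := J2 (p a b) q
    rw [hcen q, hpq, add_zero, hzero] at h
    apply two
    rw [add_zero]
    have h' := congrArg (fun t => p a b * t) h
    simp only [mul_zero, mul_add, ← mul_assoc, hpq, zero_mul, add_zero] at h'
    rw [mul_assoc (p a b) (δ (p a b)) q, ← hcen, mul_assoc, hcen q, hpq, mul_zero, zero_add,
      mul_assoc (p a b) (δ q) (p a b), hcen (δ q), ← mul_assoc] at h'
    exact h'.symm
  have hcube : p a b * p a b * p a b = 0 := by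
    apply two
    rw [add_zero, mul_assoc, ← mul_add, hpp, ← mul_assoc, hppq]
  have hsq : p a b * p a b = 0 := by
    apply hB
    intro x
    rw [mul_assoc (p a b * p a b) x, ← mul_assoc x, hcen x, ← mul_assoc, ← mul_assoc, hcube]
    simp
  have h0 : p a b = 0 := by
    apply hB
    intro x
    rw [mul_assoc, hcen, ← mul_assoc, hsq, zero_mul]
  rw [hp, sub_sub, sub_eq_zero] at h0
  exact h0

end SemiprimeJordan

/-! ### Characters of the coefficient algebra. -/

section Character

open WeakDual

variable {A : Type*} [CommCStarAlgebra A]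

theorem eq_zero_of_forall_character_eq_zero {a : A} (h : ∀ χ : characterSpace ℂ A, χ a = 0) :
    a = 0 := by
  apply (gelfandTransform_bijective A).1
  ext χ
  simpa using h χ

variable [PartialOrder A] [StarOrderedRing A]

/-- The kernel of a character is spanned by the squares of its elements. -/
theorem mem_span_sq_of_character_eq_zero (χ : characterSpace ℂ A) {b : A} (hb : χ b = 0) :
    b ∈ Submodule.span ℂ {a : A | ∃ c : A, χ c = 0 ∧ a = c * c} := by
  have hnonneg : ∀ b : A, 0 ≤ b → χ b = 0 →
      b ∈ Submodule.span ℂ {a : A | ∃ c : A, χ c = 0 ∧ a = c * c} := by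
    intro b hb0 hb
    have h := CFC.sqrt_mul_sqrt_self b hb0
    refine Submodule.subset_span ⟨CFC.sqrt b, ?_, h.symm⟩
    rw [← h, map_mul] at hb
    exact mul_self_eq_zero.mp hb
  have hsa : ∀ b : A, IsSelfAdjoint b → χ b = 0 →
      b ∈ Submodule.span ℂ {a : A | ∃ c : A, χ c = 0 ∧ a = c * c} := by
    intro b hb0 hb
    -- Under `χ` the two parts have equal values with product zero, so both lie in the kernel.
    have h1 := CFC.posPart_sub_negPart b hb0
    have h2 := congrArg χ (CFC.posPart_mul_negPart b)
    rw [map_mul, map_zero] at h2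
    have h3 : χ (b⁺) = χ (b⁻) := by
      rw [← sub_eq_zero, ← map_sub, h1, hb]
    have h4 : χ (b⁻) = 0 := by
      rw [h3] at h2
      exact mul_self_eq_zero.mp h2
    rw [← h1]
    exact Submodule.sub_mem _ (hnonneg _ (CFC.posPart_nonneg b) (h3.trans h4))
      (hnonneg _ (CFC.negPart_nonneg b) h4)
  have hstar : χ (star b) = 0 := by rw [map_star, hb, star_zero]
  have h1 : b = (2⁻¹ : ℂ) • (b + star b) - (2⁻¹ * Complex.I) • (Complex.I • (b - star b)) := by
    rw [smul_smul, mul_assoc, Complex.I_mul_I, ← sub_eq_zero]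
    module
  have h2 : IsSelfAdjoint (b + star b) := by
    rw [IsSelfAdjoint, star_add, star_star, add_comm]
  have h3 : IsSelfAdjoint (Complex.I • (b - star b)) := by
    rw [IsSelfAdjoint, star_smul, star_sub, star_star, Complex.star_def, Complex.conj_I]
    module
  rw [h1]
  refine Submodule.sub_mem _ (Submodule.smul_mem _ _ (hsa _ h2 ?_))
    (Submodule.smul_mem _ _ (hsa _ h3 ?_))
  · rw [map_add, hb, hstar, add_zero]
  · rw [map_smul, map_sub, hb, hstar, sub_zero, smul_zero]

end Character

/-! ### Rank one operators and derivations on the module. -/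

namespace HilbertModuleEnd

variable {A M : Type*} [CommCStarAlgebra A] [PartialOrder A]
    [NormedAddCommGroup M] [NormedSpace ℂ M] [Module A M] [CStarModule A M]

theorem eq_of_forall_inner {x y : M} (h : ∀ u : M, inner A u x = inner A u y) : x = y := by
  have : inner A (x - y) (x - y) = 0 := by
    rw [CStarModule.inner_sub_right, h, sub_self]
  exact sub_eq_zero.mp (CStarModule.inner_self.mp this)

theorem smul_smul_eq (c : ℂ) (a : A) (x : M) : (c • a) • x = c • (a • x) :=
  eq_of_forall_inner (A := A) fun u => by simp

theorem norm_smul_le_mul (a : A) (x : M) : ‖a • x‖ ≤ ‖a‖ * ‖x‖ := by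
  refine (sq_le_sq₀ (norm_nonneg _) (by positivity)).mp ?_
  rw [CStarModule.norm_sq_eq A, mul_pow, CStarModule.norm_sq_eq A (x := x)]
  calc ‖inner A (a • x) (a • x)‖ = ‖a * (inner A x x * star a)‖ := by simp
    _ ≤ ‖a‖ * (‖inner A x x‖ * ‖star a‖) :=
        (norm_mul_le _ _).trans (by gcongr; exact norm_mul_le _ _)
    _ = ‖a‖ ^ 2 * ‖inner A x x‖ := by rw [norm_star]; ring

@[ext]
theorem ext_apply {S T : HilbertModuleEnd A M} (h : ∀ x, S.1 x = T.1 x) : S = T :=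
  Subtype.ext (ContinuousLinearMap.ext h)

variable (M) in
/-- The operator of multiplication by an element of the coefficient algebra. -/
def scalar (a : A) : HilbertModuleEnd A M :=
  ⟨LinearMap.mkContinuous
    { toFun := fun x => a • x
      map_add' := fun x y => smul_add a x y
      map_smul' := fun c x => hilbertModule_smul_comm A M c a x } ‖a‖ (norm_smul_le_mul a),
    fun b x => smul_comm a b x⟩

@[simp] theorem scalar_apply (a : A) (x : M) : (scalar M a).1 x = a • x := rfl

theorem mul_apply (S T : HilbertModuleEnd A M) (x : M) : (S * T).1 x = S.1 (T.1 x) := rfl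

theorem map_smul_scalar (T : HilbertModuleEnd A M) (a : A) (x : M) : T.1 (a • x) = a • T.1 x :=
  T.2 a x

theorem scalar_mul (a b : A) : scalar M (a * b) = scalar M a * scalar M b := by
  ext x; simp [mul_smul]

theorem scalar_comm (a : A) (T : HilbertModuleEnd A M) : scalar M a * T = T * scalar M a := by
  ext x; simp [map_smul_scalar]

variable (A M) in
/-- Multiplication by elements of the coefficient algebra, as a linear map. -/
def scalarₗ : A →ₗ[ℂ] HilbertModuleEnd A M where
  toFun := scalar M
  map_add' a b := by ext x; exact add_smul a b x
  map_smul' c a := by ext x; exact smul_smul_eq c a x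

theorem scalar_one : scalar M (1 : A) = 1 := by
  ext x; exact one_smul A x

theorem eq_zero_of_inner_self_smul {x : M} (h : inner A x x • x = (0 : M)) : x = 0 := by
  have h1 : inner A x x * inner A x x = (0 : A) := by
    rw [← CStarModule.inner_op_smul_right, h, CStarModule.inner_zero_right]
  have h2 : star (inner A x x) * inner A x x = (0 : A) := by rwa [CStarModule.star_inner]
  exact CStarModule.inner_self.mp (CStarRing.star_mul_self_eq_zero_iff _ |>.mp h2)

variable [StarOrderedRing A]

/-- The rank one operator `w ↦ ⟨y, w⟩ z`. -/
def rankOne (y z : M) : HilbertModuleEnd A M :=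
  ⟨LinearMap.mkContinuous
    { toFun := fun w => (inner A y w : A) • z
      map_add' := fun v w => by rw [CStarModule.inner_add_right, add_smul]
      map_smul' := fun c w => by
        rw [CStarModule.inner_smul_right_complex, smul_smul_eq, RingHom.id_apply] }
    (‖y‖ * ‖z‖) (fun w => (norm_smul_le_mul _ _).trans <| by
        calc ‖inner A y w‖ * ‖z‖ ≤ ‖y‖ * ‖w‖ * ‖z‖ := by gcongr; exact CStarModule.norm_inner_le M
          _ = ‖y‖ * ‖z‖ * ‖w‖ := by ring),
    fun b x => by
      change (inner A y (b • x) : A) • z = b • ((inner A y x : A) • z)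
      rw [CStarModule.inner_op_smul_right, mul_smul]⟩

@[simp] theorem rankOne_apply (y z w : M) :
    (rankOne (A := A) y z).1 w = (inner A y w : A) • z := rfl

theorem rankOne_mul_mul_rankOne (T : HilbertModuleEnd A M) (y z : M) :
    rankOne y z * T * rankOne y z = scalar M (inner A y (T.1 z)) * rankOne y z := by
  ext w
  simp only [mul_apply, rankOne_apply, scalar_apply, map_smul_scalar]

theorem semiprime (T : HilbertModuleEnd A M) (h : ∀ X, T * X * T = 0) : T = 0 := by
  ext x
  refine eq_zero_of_inner_self_smul (A := A) ?_
  -- This choice of `X` gives `T X T x = ⟨Tx, Tx⟩ Tx`.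
  have := congrArg (fun S : HilbertModuleEnd A M => S.1 x) (h (rankOne (T.1 x) x))
  simpa [mul_apply, map_smul_scalar] using this

theorem eq_zero_of_rankOne_mul_mul_rankOne (T : HilbertModuleEnd A M)
    (h : ∀ y z, rankOne y z * T * rankOne y z = 0) : T = 0 := by
  ext x
  -- With `a = ⟨Tx, Tx⟩` this reads `a²x = 0`; applying `T` and pairing with `Tx` gives `a³ = 0`.
  have h1 := congrArg (fun S : HilbertModuleEnd A M => S.1 (T.1 x)) (h (T.1 x) x)
  rw [rankOne_mul_mul_rankOne] at h1
  simp only [mul_apply, rankOne_apply, scalar_apply] at h1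
  have h2 := congrArg T.1 (show _ = (0 : M) from h1)
  rw [map_smul_scalar, map_smul_scalar, map_zero] at h2
  have h3 := congrArg (fun v => (inner A (T.1 x) v : A)) h2
  simp only [CStarModule.inner_op_smul_right, CStarModule.inner_zero_right] at h3
  set a : A := inner A (T.1 x) (T.1 x) with ha
  have hs : star a = a := CStarModule.star_inner _ _
  have h4 : a * a = 0 := by
    refine (CStarRing.star_mul_self_eq_zero_iff _).mp ?_
    rw [star_mul, hs, mul_assoc, h3, mul_zero]
  exact CStarModule.inner_self.mp
    ((CStarRing.star_mul_self_eq_zero_iff a).mp (by rw [hs, h4]))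

/-- Each matrix coefficient of `d` on scalars, followed by a character `χ`, kills squares from `ker
χ` by Leibniz, hence all of `ker χ`, and also `1`. No continuity of `d` is needed. -/
theorem derivation_scalar {d : HilbertModuleEnd A M → HilbertModuleEnd A M}
    (hd : IsAlgDerivation d) (a : A) : d (scalar M a) = 0 := by
  have d_one : d 1 = 0 := by
    have := hd.leibniz 1 1
    simpa using this
  ext y
  refine eq_of_forall_inner (A := A) fun x => ?_
  rw [show (0 : HilbertModuleEnd A M).1 y = 0 from rfl, CStarModule.inner_zero_right]
  refine eq_zero_of_forall_character_eq_zero fun χ => ?_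
  let D : A →ₗ[ℂ] ℂ :=
    { toFun := fun b => χ (inner A x ((d (scalarₗ A M b)).1 y))
      map_add' := fun b c => by
        rw [map_add, hd.isLinearMap.map_add, ← map_add, ← CStarModule.inner_add_right]; rfl
      map_smul' := fun c b => by
        rw [map_smul, hd.isLinearMap.map_smul, RingHom.id_apply, ← map_smul,
          ← CStarModule.inner_smul_right_complex]; rfl }
  have hker : Submodule.span ℂ {b : A | ∃ c : A, χ c = 0 ∧ b = c * c} ≤ LinearMap.ker D := by
    rw [Submodule.span_le]
    rintro _ ⟨c, hc, rfl⟩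
    change χ (inner A x ((d (scalar M (c * c))).1 y)) = 0
    rw [scalar_mul, hd.leibniz, ← scalar_comm]
    change χ (inner A x (c • (d (scalar M c)).1 y + c • (d (scalar M c)).1 y)) = 0
    simp [hc]
  have hmem : a - χ a • (1 : A) ∈ LinearMap.ker D :=
    hker (mem_span_sq_of_character_eq_zero χ (by simp))
  have h1 : D 1 = 0 := by
    change χ (inner A x ((d (scalar M (1 : A))).1 y)) = 0
    rw [scalar_one, d_one, show (0 : HilbertModuleEnd A M).1 y = 0 from rfl, CStarModule.inner_zero_right,
      map_zero]
  rw [LinearMap.mem_ker, map_sub, map_smul, h1, smul_zero, sub_zero] at hmem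
  exact hmem

theorem derivation_scalar_mul {d : HilbertModuleEnd A M → HilbertModuleEnd A M}
    (hd : IsAlgDerivation d) (a : A) (T : HilbertModuleEnd A M) :
    d (scalar M a * T) = scalar M a * d T := by
  rw [hd.leibniz, derivation_scalar hd, zero_mul, zero_add]

/-- The auxiliary derivation depends on `T`, but it enters only through its values at `T` and
`rankOne y z`, where it equals `δ`. -/
theorem twoLocalDerivation_compression
    {δ : HilbertModuleEnd A M → HilbertModuleEnd A M} (hδ : IsTwoLocalDerivation δ)
    (T : HilbertModuleEnd A M) (y z : M) :
    rankOne y z * δ T * rankOne y z = scalar M (inner A y (T.1 z)) * δ (rankOne y z)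
      - δ (rankOne y z) * T * rankOne y z - rankOne y z * T * δ (rankOne y z) := by
  obtain ⟨d, hd, hT, hF⟩ := hδ T (rankOne y z)
  rw [hT, hF, ← derivation_scalar_mul hd, ← rankOne_mul_mul_rankOne, hd.leibniz, hd.leibniz]
  noncomm_ring

theorem twoLocalDerivation_isLinearMap
    {δ : HilbertModuleEnd A M → HilbertModuleEnd A M} (hδ : IsTwoLocalDerivation δ) :
    IsLinearMap ℂ δ where
  map_add S T := by
    rw [← sub_eq_zero]
    refine eq_zero_of_rankOne_mul_mul_rankOne _ fun y z => ?_
    have h : scalar M (inner A y ((S + T).1 z))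
        = scalar M (inner A y (S.1 z)) + scalar M (inner A y (T.1 z)) := by
      rw [show (S + T).1 z = S.1 z + T.1 z from rfl, CStarModule.inner_add_right]
      exact (scalarₗ A M).map_add _ _
    rw [mul_sub, mul_add, sub_mul, add_mul, twoLocalDerivation_compression hδ,
      twoLocalDerivation_compression hδ, twoLocalDerivation_compression hδ, h]
    noncomm_ring
  map_smul c T := by
    obtain ⟨d, hd, h1, h2⟩ := hδ (c • T) T
    rw [h1, h2, hd.isLinearMap.map_smul]

end HilbertModuleEnd

theorem mainTheorem2 (A M : Type*) [CommCStarAlgebra A] [PartialOrder A] [StarOrderedRing A]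
    [NormedAddCommGroup M] [NormedSpace ℂ M] [Module A M] [CStarModule A M] [CompleteSpace M]
    (hfull : IsFullHilbertModule A M)
    (δ : HilbertModuleEnd A M → HilbertModuleEnd A M) (hδ : IsTwoLocalDerivation δ) :
    IsAlgDerivation δ := by
  refine isAlgDerivation_of_jordan HilbertModuleEnd.semiprime δ
    (HilbertModuleEnd.twoLocalDerivation_isLinearMap hδ) fun T => ?_
  obtain ⟨d, hd, h1, h2⟩ := hδ (T * T) T
  rw [h1, h2, hd.leibniz]
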